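/- Let $a_1,a_2>0$, let $q$ be a real-valued function that is continuous on $[-1,0)\cup(0,1]$ and has finite one-sided limits $q(0\pm)$, and let $\beta_1,\beta_2,\delta_1,\delta_2\in\mathbb R$ with $|\beta_1|+|\beta_2|\neq0$ and $|\delta_1|+|\delta_2|\neq 0$. Let $a(x)=a_1^4$ on $[-1,0)$ and $a(x)=a_2^4$ on $(0,1]$, and consider, for $\lambda\in\mathbb C$, the equation $$(a(x)u''(x))''+q(x)u(x)=\lambda u(x).\qquad(*)$$ Let $\phi_{11}(\cdot,\lambda)$ and $\phi_{21}(\cdot,\lambda)$ be the solutions of $(*)$ on $[-1,0)$ with $$\phi_{11}=\phi_{11}'=\phi_{11}''=0,\quad \phi_{11}'''=-1\quad\text{at }x=-1,\qquad \phi_{21}=0,\quad \phi_{21}'=\beta_2,\quad \phi_{21}''=-\beta_1,\quad \phi_{21}'''=0\quad\text{at }x=-1,$$ and for $i=1,2$ let $\phi_{i2}(\cdot,\lambda)$ be the solution of $(*)$ on $(0,1]$ with $$\phi_{i2}(0)=\phi_{i1}(0),\quad \phi_{i2}'(0)=\phi_{i1}'(0),\quad \phi_{i2}''(0)=\phi_{i1}''(0)-\lambda\delta_1\phi_{i1}'(0),\quad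 \phi_{i2}'''(0)=\phi_{i1}'''(0)-\lambda\delta_2\phi_{i1}(0),$$ where values at $0$ are one-sided limits, from the left for $\phi_{i1}$ and from the right for $\phi_{i2}$. These solutions exist for every $\lambda\in\mathbb C$. Moreover, with $\lambda=s^4$, $s\in\mathbb C$, the following holds for $k=0,1,2,3$ as $|\lambda|\to\infty$, uniformly in $x\in[-1,0]$ for $\phi_{11},\phi_{21}$ and uniformly in $x\in[0,1]$ for $\phi_{12},\phi_{22}$ (derivatives at end points are one-sided): $$\frac{d^k}{dx^k}\phi_{11}(x,\lambda)=O\!\left(|s|^{k-1}e^{|s|\frac{x+1}{a_1}}\right),$$ $$\begin{aligned}\frac{d^k}{dx^k}\phi_{12}(x,\lambda)={}&\frac{a_2^2s^2\delta_1\phi_{11}'(0)}{2}\frac{d^k}{dx^k}\cos\frac{sx}{a_2}+\frac{a_2^3s\delta_2\phi_{11}(0)}{2}\frac{d^k}{dx^k}\sin\frac{sx}{a_2}-\frac{a_2^2s^2\delta_1\phi_{11}'(0)}{4}\frac{d^k}{dx^k}\left(e^{\frac{sx}{a_2}}+e^{-\frac{sx}{a_2}}\right)\\&-\frac{a_2^3s\delta_2\phi_{11}(0)}{4}\frac{d^k}{dx^k}\left(e^{\frac{sx}{a_2}}-e^{-\frac{sx}{a_2}}\right)+O\!\left(|s|^{k}e^{|s|\frac{a_1x+a_2}{a_1a_2}}\right),\end{aligned}$$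 $$\frac{d^k}{dx^k}\phi_{21}(x,\lambda)=\frac{\beta_2a_1}{2s}\frac{d^k}{dx^k}\sin\frac{s(x+1)}{a_1}+\frac{\beta_2a_1}{4s}\frac{d^k}{dx^k}\left(e^{\frac{s(x+1)}{a_1}}-e^{-\frac{s(x+1)}{a_1}}\right)+O\!\left(|s|^{k-2}e^{|s|\frac{x+1}{a_1}}\right),$$ $$\begin{aligned}\frac{d^k}{dx^k}\phi_{22}(x,\lambda)={}&\frac{a_2^2s^2\delta_1\phi_{21}'(0)}{2}\frac{d^k}{dx^k}\cos\frac{sx}{a_2}+\frac{a_2^3s\delta_2\phi_{21}(0)}{2}\frac{d^k}{dx^k}\sin\frac{sx}{a_2}-\frac{a_2^2s^2\delta_1\phi_{21}'(0)}{4}\frac{d^k}{dx^k}\left(e^{\frac{sx}{a_2}}+e^{-\frac{sx}{a_2}}\right)\\&-\frac{a_2^3s\delta_2\phi_{21}(0)}{4}\frac{d^k}{dx^k}\left(e^{\frac{sx}{a_2}}-e^{-\frac{sx}{a_2}}\right)+O\!\left(|s|^{k-1}e^{|s|\frac{a_1x+a_2}{a_1a_2}}\right).\end{aligned}$$ Here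 $\phi_{i1}(0)$ and $\phi_{i1}'(0)$ are the values at $0-$, with $\lambda=s^4$. -/

import Mathlib

open Set Filter Topology

/-- `u` is a solution of `(a u'')'' + q u = lam u` on the interval `J`, minus the point of
discontinuity `0`, where the coefficient `a` is the constant `α ^ 4` on `J`. Here `J` is one of the
closed intervals `[-1, 0]`, `[0, 1]`, and `u` and its derivatives up to order three extend
continuously to the end point `0`; their values there (which are derivatives within `J`) are the
one-sided limits at `0`. The equation is not imposed at `0`, where `q` need not be
defined. -/
structure IsSolutionOn (J : Set ℝ) (α : ℝ) (q : ℝ → ℝ) (lam : ℂ) (u : ℝ → ℂ) : Prop where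
  contDiffOn : ContDiffOn ℝ 3 u J
  equation : ∀ x ∈ J \ {0}, ∃ d : ℂ,
    HasDerivWithinAt (iteratedDerivWithin 3 u J) d J x ∧
      (α : ℂ) ^ 4 * d + (q x : ℂ) * u x = lam * u x

/-- `u` has the Cauchy data `u = c₀`, `u' = c₁`, `u'' = c₂`, `u''' = c₃` at the point `x₀` of `J`
(derivatives within `J`, hence one-sided at an end point). -/
def HasCauchyData (J : Set ℝ) (x₀ : ℝ) (u : ℝ → ℂ) (c₀ c₁ c₂ c₃ : ℂ) : Prop :=
  u x₀ = c₀ ∧ iteratedDerivWithin 1 u J x₀ = c₁ ∧ iteratedDerivWithin 2 u J x₀ = c₂ ∧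
    iteratedDerivWithin 3 u J x₀ = c₃

/-- The left interval, with the one-sided end point `0-` added. -/
abbrev leftI : Set ℝ := Icc (-1) 0

/-- The right interval, with the one-sided end point `0+` added. -/
abbrev rightI : Set ℝ := Icc 0 1

/-- `v`, on the right interval, continues `u`, on the left interval, across `0` by the transmission
conditions: `v` and `v'` agree with `u` and `u'` at `0`, and
`v''(0) = u''(0) - lam δ₁ u'(0)`, `v'''(0) = u'''(0) - lam δ₂ u(0)`. -/
def Transmits (δ₁ δ₂ : ℝ) (lam : ℂ) (u v : ℝ → ℂ) : Prop :=
  HasCauchyData rightI 0 v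
    (u 0)
    (iteratedDerivWithin 1 u leftI 0)
    (iteratedDerivWithin 2 u leftI 0 - lam * δ₁ * iteratedDerivWithin 1 u leftI 0)
    (iteratedDerivWithin 3 u leftI 0 - lam * δ₂ * u 0)

/-- The four functions `φ₁₁(·, lam)`, `φ₂₁(·, lam)` on the left interval and `φ₁₂(·, lam)`,
`φ₂₂(·, lam)` on the right interval. -/
structure IsPhiSystem (a₁ a₂ : ℝ) (q : ℝ → ℝ) (β₁ β₂ δ₁ δ₂ : ℝ) (lam : ℂ)
    (φ₁₁ φ₁₂ φ₂₁ φ₂₂ : ℝ → ℂ) : Prop where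
  sol₁₁ : IsSolutionOn leftI a₁ q lam φ₁₁
  init₁₁ : HasCauchyData leftI (-1) φ₁₁ 0 0 0 (-1)
  sol₁₂ : IsSolutionOn rightI a₂ q lam φ₁₂
  trans₁₂ : Transmits δ₁ δ₂ lam φ₁₁ φ₁₂
  sol₂₁ : IsSolutionOn leftI a₁ q lam φ₂₁
  init₂₁ : HasCauchyData leftI (-1) φ₂₁ 0 β₂ (-β₁) 0
  sol₂₂ : IsSolutionOn rightI a₂ q lam φ₂₂
  trans₂₂ : Transmits δ₁ δ₂ lam φ₂₁ φ₂₂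

/-- `f x s = O(g x s)` as `|s| → ∞` in `ℂ`, uniformly for `x ∈ J`. -/
def UniformBigO (J : Set ℝ) (f : ℝ → ℂ → ℂ) (g : ℝ → ℂ → ℝ) : Prop :=
  ∃ C R : ℝ, ∀ s : ℂ, R ≤ ‖s‖ → ∀ x ∈ J, ‖f x s‖ ≤ C * g x s

/-- The `k`-th `x`-derivative of the leading part on the right interval:
`(a₂² s² δ₁ p₁ / 2) cos(sx/a₂) + (a₂³ s δ₂ p₀ / 2) sin(sx/a₂)
- (a₂² s² δ₁ p₁ / 4) (e^(sx/a₂) + e^(-sx/a₂)) - (a₂³ s δ₂ p₀ / 4) (e^(sx/a₂) - e^(-sx/a₂))`,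
where `p₀`, `p₁` are the values at `0-` of the function on the left interval and of its
derivative. -/
noncomputable def rightLeading (a₂ δ₁ δ₂ : ℝ) (p₀ p₁ : ℂ) (s : ℂ) (k : ℕ) (x : ℝ) : ℂ :=
  (a₂ : ℂ) ^ 2 * s ^ 2 * δ₁ * p₁ / 2 *
      iteratedDeriv k (fun y : ℝ => Complex.cos (s * y / a₂)) x
    + (a₂ : ℂ) ^ 3 * s * δ₂ * p₀ / 2 *
      iteratedDeriv k (fun y : ℝ => Complex.sin (s * y / a₂)) x
    - (a₂ : ℂ) ^ 2 * s ^ 2 * δ₁ * p₁ / 4 *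
      iteratedDeriv k (fun y : ℝ => Complex.exp (s * y / a₂) + Complex.exp (-(s * y / a₂))) x
    - (a₂ : ℂ) ^ 3 * s * δ₂ * p₀ / 4 *
      iteratedDeriv k (fun y : ℝ => Complex.exp (s * y / a₂) - Complex.exp (-(s * y / a₂))) x

/-- The `k`-th `x`-derivative of the leading part of `φ₂₁`:
`(β₂ a₁ / (2s)) sin(s(x+1)/a₁) + (β₂ a₁ / (4s)) (e^(s(x+1)/a₁) - e^(-s(x+1)/a₁))`. -/
noncomputable def leftLeading (a₁ β₂ : ℝ) (s : ℂ) (k : ℕ) (x : ℝ) : ℂ :=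
  (β₂ : ℂ) * a₁ / (2 * s) *
      iteratedDeriv k (fun y : ℝ => Complex.sin (s * (y + 1) / a₁)) x
    + (β₂ : ℂ) * a₁ / (4 * s) *
      iteratedDeriv k
        (fun y : ℝ => Complex.exp (s * (y + 1) / a₁) - Complex.exp (-(s * (y + 1) / a₁))) x

/-! On each side of `0` the equation is `u'''' = (σ⁴ - p / α⁴) u` with `σ = s / α` and `p` the
continuous extension of `q` to the closed interval. Existence is thus the theory of linear systems
with continuous coefficients.

For the asymptotics, weight the `k`-th derivative by `r^(-k)`, `r = |σ|`. The first-order system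
then has norm about `r` in the sup norm, so Grönwall gives the sharp rate `e^(r (x - a))`, with no
oscillatory kernel or integral equation (`norm_chain_le`). If `V'''' = σ⁴ V`, then `u - V` solves
the unperturbed equation with source `-p u / α⁴`. In the weighted norm this source gains `r⁻³`, so
data of size `A` and data mismatch `B` give an error of order `B + A / r³`
(`exists_norm_iteratedDerivWithin_sub_le`).

The leading parts are combinations of `e^(±σx)`, `e^(±iσx)`, hence admissible choices of `V`. On the
left, `V` carries the datum `β₂`. On the right, `V` carries exactly the jump terms `-λδ₁u'(0)`,
`-λδ₂u(0)`. If the left solution has weighted size `P` at `0`, then `B = P` and `A = O(|s|³ P)`, so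
the gain `|s|⁻³` brings the whole error down to order `P`. -/

/-! ### Existence for linear equations of fourth order -/

/-- A time-dependent vector field that is continuous and uniformly Lipschitz in the space variable
has integral curves on every compact interval, starting from the left end point. -/
theorem exists_forall_mem_Icc_hasDerivAt_of_lipschitzWith {E : Type*} [NormedAddCommGroup E]
    [NormedSpace ℝ E] [CompleteSpace E] {f : ℝ → E → E} {K : NNReal}
    (hf : Continuous (Function.uncurry f)) (hK : ∀ t, LipschitzWith K (f t))
    {a b : ℝ} (hab : a ≤ b) (y₀ : E) :
    ∃ Y : ℝ → E, Y a = y₀ ∧ ∀ x ∈ Icc a b, HasDerivAt Y (f x (Y x)) x := by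
  -- Picard iteration in an exponentially weighted norm: the unknown is `z = e^(-M (t - a)) Y`, and
  -- the weight lowers the Lipschitz constant to `K / M ≤ 1 / 2`, so one contraction covers the
  -- whole interval. Composing with `projIcc` makes the integrand continuous on all of `ℝ`, which
  -- gives two-sided derivatives even at the end points.
  set M : ℝ := 2 * K + 1 with hM
  have hM0 : 0 < M := by positivity
  let g : C(Icc a b, E) → ℝ → E := fun z t =>
    f t (Real.exp (M * (t - a)) • z (projIcc a b hab t))
  have hg : ∀ z, Continuous (g z) := fun z => by
    have h1 : Continuous fun t : ℝ =>
        (t, Real.exp (M * (t - a)) • z (projIcc a b hab t)) := by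
      have := continuous_projIcc (h := hab)
      fun_prop
    exact hf.comp h1
  have hint : ∀ z c d, IntervalIntegrable (g z) MeasureTheory.volume c d := fun z c d =>
    (hg z).intervalIntegrable c d
  let Y : C(Icc a b, E) → ℝ → E := fun z x => y₀ + ∫ t in a..x, g z t
  have hY : ∀ z x, HasDerivAt (Y z) (g z x) x := fun z x => by
    have := intervalIntegral.integral_hasDerivAt_right (hint z a x)
      ((hg z).stronglyMeasurableAtFilter _ _) (hg z).continuousAt
    exact this.const_add y₀
  have hYc : ∀ z, Continuous (Y z) := fun z =>
    continuous_iff_continuousAt.2 fun x => (hY z x).continuousAt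
  let T : C(Icc a b, E) → C(Icc a b, E) := fun z =>
    ⟨fun x => Real.exp (-(M * (x - a))) • Y z x, by
      have := hYc z
      fun_prop⟩
  have hT : ContractingWith (1 / 2) T := by
    refine ⟨by rw [← NNReal.coe_lt_coe]; norm_num, LipschitzWith.of_dist_le_mul fun z w => ?_⟩
    rw [ContinuousMap.dist_le (by positivity)]
    intro x
    have hx := x.2
    have h1 : dist (T z x) (T w x)
        = Real.exp (-(M * (x - a))) * ‖∫ t in a..x, (g z t - g w t)‖ := by
      rw [intervalIntegral.integral_sub (hint z _ _) (hint w _ _), dist_eq_norm]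
      change ‖Real.exp (-(M * (x - a))) • (y₀ + _) - Real.exp (-(M * (x - a))) • (y₀ + _)‖ = _
      rw [← smul_sub, norm_smul, add_sub_add_left_eq_sub, Real.norm_eq_abs, Real.abs_exp]
    have h2 : ∀ t, HasDerivAt (fun t : ℝ => dist z w * K / M * Real.exp (M * (t - a)))
        (dist z w * K * Real.exp (M * (t - a))) t := fun t => by
      have := ((((hasDerivAt_id t).sub_const a).const_mul M).exp).const_mul (dist z w * K / M)
      refine this.congr_deriv ?_
      simp only [id]
      field_simp
    have h3 : ‖∫ t in a..x, (g z t - g w t)‖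
        ≤ ∫ t in a..x, dist z w * K * Real.exp (M * (t - a)) := by
      refine intervalIntegral.norm_integral_le_of_norm_le hx.1 (.of_forall fun t _ => ?_)
        (by apply Continuous.intervalIntegrable; fun_prop)
      rw [← dist_eq_norm]
      refine ((hK t).dist_le_mul _ _).trans ?_
      rw [dist_smul₀, Real.norm_eq_abs, Real.abs_exp]
      have := ContinuousMap.dist_apply_le_dist (f := z) (g := w) (projIcc a b hab t)
      calc (K : ℝ) * (Real.exp (M * (t - a)) * dist (z (projIcc a b hab t))
            (w (projIcc a b hab t)))
          ≤ K * (Real.exp (M * (t - a)) * dist z w) := by gcongr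
        _ = _ := by ring
    rw [intervalIntegral.integral_eq_sub_of_hasDerivAt (fun t _ => h2 t)
      (by apply Continuous.intervalIntegrable; fun_prop)] at h3
    have h4 : (K : ℝ) / M ≤ 1 / 2 := by
      rw [div_le_div_iff₀ hM0 two_pos, hM]; linarith
    calc dist (T z x) (T w x)
        ≤ Real.exp (-(M * (x - a))) * (dist z w * K / M * Real.exp (M * (x - a))) := by
          rw [h1]
          gcongr
          refine h3.trans (sub_le_self _ (by positivity))
      _ = K / M * dist z w := by
          rw [Real.exp_neg]
          field_simp
      _ ≤ ((1 / 2 : NNReal) : ℝ) * dist z w := by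
          push_cast
          gcongr
  have hne : Nonempty C(Icc a b, E) := ⟨ContinuousMap.const _ 0⟩
  obtain ⟨z, hz⟩ : ∃ z, T z = z := ⟨_, hT.fixedPoint_isFixedPt⟩
  -- The fixed-point equation says `e^(M (x - a)) z = Y z` on `[a, b]`, so the integrand `g z x` is
  -- `f x (Y z x)` there.
  refine ⟨Y z, by simp [Y], fun x hx => ?_⟩
  convert hY z x using 1
  change f x (Y z x) = f x (Real.exp (M * (x - a)) • z (projIcc a b hab x))
  congr 1
  rw [projIcc_of_mem hab hx]
  conv_rhs => rw [← hz]
  change _ = Real.exp (M * (x - a)) • Real.exp (-(M * (x - a))) • Y z x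
  rw [smul_smul, ← Real.exp_add]
  simp

/-- If each function of a chain is the derivative of the preceding one within `J`, the chain
consists of the iterated derivatives within `J` of its first member. -/
theorem eqOn_iteratedDerivWithin_of_chain {J : Set ℝ} (hJ : UniqueDiffOn ℝ J) {n : ℕ}
    {f : ℕ → ℝ → ℂ}
    (hf : ∀ k < n, ∀ x ∈ J, HasDerivWithinAt (f k) (f (k + 1) x) J x) :
    ∀ k ≤ n, EqOn (iteratedDerivWithin k (f 0) J) (f k) J := by
  intro k
  induction k with
  | zero => intro _ x _; simp
  | succ k ih =>
    intro hk x hx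
    rw [iteratedDerivWithin_succ, derivWithin_congr (ih (by omega)) (ih (by omega) hx)]
    exact (hf k (by omega) x hx).derivWithin (hJ x hx)

theorem iteratedDeriv_of_chain {f : ℕ → ℝ → ℂ}
    (hf : ∀ k x, HasDerivAt (f k) (f (k + 1) x) x) (k : ℕ) :
    iteratedDeriv k (f 0) = f k := by
  induction k with
  | zero => simp
  | succ k ih => rw [iteratedDeriv_succ, ih]; exact funext fun x => (hf k x).deriv

/-- The linear equation `u'''' = p u` with continuous `p` has solutions with arbitrary Cauchy data
at the left end point. -/
theorem exists_fourth_order_solution {a b : ℝ} (hab : a < b) {p : ℝ → ℂ}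
    (hp : ContinuousOn p (Icc a b)) (c₀ c₁ c₂ c₃ : ℂ) :
    ∃ u : ℝ → ℂ, ContDiffOn ℝ 3 u (Icc a b) ∧ HasCauchyData (Icc a b) a u c₀ c₁ c₂ c₃ ∧
      ∀ x ∈ Icc a b, HasDerivWithinAt (iteratedDerivWithin 3 u (Icc a b)) (p x * u x)
        (Icc a b) x := by
  -- Constant extension beyond the end points makes the vector field continuous on `ℝ` and uniformly
  -- Lipschitz.
  set P : ℝ → ℂ := IccExtend hab.le (domRestrict (Icc a b) p) with hP
  have hPc : Continuous P := (continuousOn_iff_continuous_domRestrict.1 hp).Icc_extend'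
  have hPp : ∀ x ∈ Icc a b, P x = p x := fun x hx => IccExtend_of_mem _ _ hx
  obtain ⟨C, hC⟩ : ∃ C, ∀ x, ‖P x‖ ≤ C := by
    obtain ⟨C, hC⟩ := isCompact_Icc.exists_bound_of_continuousOn hp
    exact ⟨C, fun x => hC _ (projIcc a b hab.le x).2⟩
  let f : ℝ → (Fin 4 → ℂ) → (Fin 4 → ℂ) := fun t y => ![y 1, y 2, y 3, P t * y 0]
  have hf : Continuous (Function.uncurry f) := by
    refine continuous_pi fun i => ?_
    fin_cases i <;> simp [f, Function.uncurry] <;> fun_prop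
  have hK : ∀ t, LipschitzWith (Real.toNNReal (max 1 C)) (f t) := fun t => by
    refine LipschitzWith.of_dist_le_mul fun y z => ?_
    rw [Real.coe_toNNReal _ (zero_le_one.trans (le_max_left _ _)), dist_pi_le_iff (by positivity)]
    have h : ∀ i, dist (y i) (z i) ≤ max 1 C * dist y z := fun i =>
      (dist_le_pi_dist y z i).trans
        (le_mul_of_one_le_left dist_nonneg (le_max_left _ _))
    intro i
    fin_cases i
    · exact h 1
    · exact h 2
    · exact h 3
    · change dist (P t * y 0) (P t * z 0) ≤ _
      rw [dist_eq_norm, ← mul_sub, norm_mul, ← dist_eq_norm]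
      exact mul_le_mul ((hC t).trans (le_max_right _ _)) (dist_le_pi_dist y z 0) dist_nonneg
        (by positivity)
  obtain ⟨Y, hY0, hY⟩ :=
    exists_forall_mem_Icc_hasDerivAt_of_lipschitzWith hf hK hab.le ![c₀, c₁, c₂, c₃]
  have hYi : ∀ x ∈ Icc a b, ∀ i, HasDerivWithinAt (fun t => Y t i) (f x (Y x) i) (Icc a b) x :=
    fun x hx i => (hasDerivAt_pi.1 (hY x hx) i).hasDerivWithinAt
  -- The default `0` is never reached: the chain is used only up to index `3`.
  let F : ℕ → ℝ → ℂ := fun k t => if h : k < 4 then Y t ⟨k, h⟩ else 0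
  have hF : ∀ k < 3, ∀ x ∈ Icc a b, HasDerivWithinAt (F k) (F (k + 1) x) (Icc a b) x := by
    intro k hk x hx
    interval_cases k
    · exact hYi x hx 0
    · exact hYi x hx 1
    · exact hYi x hx 2
  have hJ := uniqueDiffOn_Icc hab
  have hD := eqOn_iteratedDerivWithin_of_chain hJ hF
  have ha : a ∈ Icc a b := left_mem_Icc.2 hab.le
  refine ⟨F 0, ?_, ⟨?_, ?_, ?_, ?_⟩, fun x hx => ?_⟩
  · refine contDiffOn_of_continuousOn_differentiableOn_deriv (n := 3) (fun m hm => ?_)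
      fun m hm => ?_
    · have hm' : m ≤ 3 := by exact_mod_cast hm
      refine ContinuousOn.congr (fun x hx => ?_) (hD m hm')
      have h4 : m < 4 := by omega
      simpa only [F, h4, dif_pos] using (hYi x hx ⟨m, h4⟩).continuousWithinAt
    · have hm' : m < 3 := by exact_mod_cast hm
      exact DifferentiableOn.congr (fun x hx => (hF m hm' x hx).differentiableWithinAt)
        (hD m hm'.le)
  · simp [F, hY0]
  · rw [hD 1 (by norm_num) ha]; simp [F, hY0]
  · rw [hD 2 (by norm_num) ha]; simp [F, hY0]
  · rw [hD 3 (by norm_num) ha]; simp [F, hY0]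
  · rw [← hPp x hx]
    exact (hYi x hx 3).congr (hD 3 le_rfl) (hD 3 le_rfl hx)

/-! ### Weighted Grönwall estimate and comparison with the unperturbed equation -/

/-- Sharp Grönwall estimate for a chain `w₀' = w₁`, `w₁' = w₂`, `w₂' = w₃`, with
`|w₃'| ≤ r⁴ |w₀| + r³ F e^{r (x - a)}`, in the sup norm weighted with powers of `r`. -/
theorem norm_chain_le {a b r A F : ℝ} (hr : 0 < r) {w : ℕ → ℝ → ℂ} {d : ℝ → ℂ}
    (hc : ∀ k ≤ 3, ContinuousOn (w k) (Icc a b))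
    (hw : ∀ k < 3, ∀ x ∈ Ico a b, HasDerivWithinAt (w k) (w (k + 1) x) (Ici x) x)
    (hw3 : ∀ x ∈ Ico a b, HasDerivWithinAt (w 3) (d x) (Ici x) x)
    (hd : ∀ x ∈ Ico a b, ‖d x‖ ≤ r ^ 4 * ‖w 0 x‖ + r ^ 3 * (F * Real.exp (r * (x - a))))
    (hF : 0 ≤ F) (hA : ∀ k ≤ 3, ‖w k a‖ ≤ r ^ k * A) :
    ∀ x ∈ Icc a b, ∀ k ≤ 3, ‖w k x‖ ≤ r ^ k * ((A + F * (x - a)) * Real.exp (r * (x - a))) := by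
  -- With these weights every component of `W'` is at most `r ‖W‖`, up to the source in the last
  -- one, so the growth rate is `r` itself.
  let W : ℝ → Fin 4 → ℂ := fun x i => ((r ^ (i : ℕ) : ℝ) : ℂ)⁻¹ * w i x
  let D : ℝ → Fin 4 → ℂ := fun x i =>
    ((r ^ (i : ℕ) : ℝ) : ℂ)⁻¹ * ![w 1 x, w 2 x, w 3 x, d x] i
  have hWn : ∀ x (i : Fin 4), ‖W x i‖ = (r ^ (i : ℕ))⁻¹ * ‖w i x‖ := fun x i => by
    rw [norm_mul, norm_inv, Complex.norm_real, Real.norm_of_nonneg (by positivity)]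
  have hA0 : 0 ≤ A := by simpa using (norm_nonneg _).trans (hA 0 (by norm_num))
  have key : ∀ x ∈ Icc a b, ‖W x‖ ≤ (A + F * (x - a)) * Real.exp (r * (x - a)) := by
    have hB : ∀ G x, HasDerivAt (fun x => (A + G * (x - a)) * Real.exp (r * (x - a)))
        (G * Real.exp (r * (x - a)) + (A + G * (x - a)) * (Real.exp (r * (x - a)) * r)) x := by
      intro G x
      have h1 := (((hasDerivAt_id x).sub_const a).const_mul G).const_add A
      have h2 := (((hasDerivAt_id x).sub_const a).const_mul r).exp
      exact (h1.mul h2).congr_deriv (by simp)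
    have hbound : ∀ x ∈ Ico a b, ‖D x‖ ≤ r * ‖W x‖ + F * Real.exp (r * (x - a)) := by
      intro x hx
      have hFe : 0 ≤ F * Real.exp (r * (x - a)) := by positivity
      have hWi : ∀ i : Fin 4, ‖w i x‖ ≤ r ^ (i : ℕ) * ‖W x‖ := fun i => by
        have := norm_le_pi_norm (W x) i
        rw [hWn, inv_mul_le_iff₀ (by positivity)] at this
        exact this
      refine (pi_norm_le_iff_of_nonneg (by positivity)).2 fun i => ?_
      rw [norm_mul, norm_inv, Complex.norm_real, Real.norm_of_nonneg (by positivity),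
        inv_mul_le_iff₀ (by positivity)]
      have hrF : ∀ k : ℕ, 0 ≤ r ^ k * (F * Real.exp (r * (x - a))) := fun k => by positivity
      fin_cases i
      · have := hWi 1; have := hrF 0; simp at *; linarith
      · have := hWi 2; have := hrF 1; simp at *; linarith
      · have := hWi 3; have := hrF 2; simp at *; linarith
      · have h0 := hWi 0
        have := hd x hx
        have h4 : r ^ 4 * ‖w 0 x‖ ≤ r ^ 4 * ‖W x‖ := by
          gcongr; simpa using h0
        simp at *; linarith
    have hWc : ContinuousOn W (Icc a b) :=
      continuousOn_pi.2 fun i => continuousOn_const.mul (hc i (by omega))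
    have hWd : ∀ x ∈ Ico a b, HasDerivWithinAt W (D x) (Ici x) x := fun x hx => by
      refine hasDerivWithinAt_pi.2 fun i => HasDerivWithinAt.const_mul _ ?_
      fin_cases i
      · exact hw 0 (by norm_num) x hx
      · exact hw 1 (by norm_num) x hx
      · exact hw 2 (by norm_num) x hx
      · exact hw3 x hx
    have hWa : ‖W a‖ ≤ A := (pi_norm_le_iff_of_nonneg hA0).2 fun i => by
      rw [hWn, inv_mul_le_iff₀ (by positivity)]
      exact hA i (by omega)
    -- The comparison principle needs a strict inequality between the derivatives at contact points;
    -- `ε` provides it and then tends to `0`.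
    have H : ∀ x ∈ Icc a b, ∀ ε > 0,
        ‖W x‖ ≤ (A + (F + ε) * (x - a)) * Real.exp (r * (x - a)) := by
      intro x hx ε hε
      refine image_norm_le_of_norm_deriv_right_lt_deriv_boundary hWc hWd (by simpa using hWa)
        (hB (F + ε)) (fun y hy hyB => (hbound y hy).trans_lt ?_) hx
      rw [hyB]
      have := mul_pos hε (Real.exp_pos (r * (y - a)))
      linarith
    intro x hx
    have ht : Tendsto (fun ε => (A + (F + ε) * (x - a)) * Real.exp (r * (x - a))) (𝓝[>] 0)
        (𝓝 ((A + (F + 0) * (x - a)) * Real.exp (r * (x - a)))) :=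
      tendsto_nhdsWithin_of_tendsto_nhds (Continuous.tendsto (by fun_prop) 0)
    rw [add_zero] at ht
    exact ge_of_tendsto ht (eventually_nhdsWithin_of_forall fun ε hε => H x hx ε hε)
  intro x hx k hk
  have := (norm_le_pi_norm (W x) ⟨k, by omega⟩).trans (key x hx)
  rw [hWn, inv_mul_le_iff₀ (by positivity)] at this
  exact this

theorem IsSolutionOn.hasDerivWithinAt_iteratedDerivWithin {a b α : ℝ} (hab : a < b) {q : ℝ → ℝ}
    {lam : ℂ} {u : ℝ → ℂ} (hu : IsSolutionOn (Icc a b) α q lam u) {k : ℕ} (hk : k < 3) {x : ℝ}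
    (hx : x ∈ Icc a b) :
    HasDerivWithinAt (iteratedDerivWithin k u (Icc a b))
      (iteratedDerivWithin (k + 1) u (Icc a b) x) (Icc a b) x := by
  rw [iteratedDerivWithin_succ]
  exact (hu.contDiffOn.differentiableOn_iteratedDerivWithin (by exact_mod_cast hk)
    (uniqueDiffOn_Icc hab) x hx).hasDerivWithinAt

theorem IsSolutionOn.continuousOn_iteratedDerivWithin {a b α : ℝ} (hab : a < b) {q : ℝ → ℝ}
    {lam : ℂ} {u : ℝ → ℂ} (hu : IsSolutionOn (Icc a b) α q lam u) {k : ℕ} (hk : k ≤ 3) :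
    ContinuousOn (iteratedDerivWithin k u (Icc a b)) (Icc a b) :=
  hu.contDiffOn.continuousOn_iteratedDerivWithin (by exact_mod_cast hk) (uniqueDiffOn_Icc hab)

/-- If `q` agrees away from `0` with a function `p` that is continuous on `[a, b]`, then the third
derivative of a solution is differentiable from the right at every point of `[a, b)`, including
`0`. -/
theorem IsSolutionOn.hasDerivWithinAt_Ici {a b α : ℝ} (hα : 0 < α)
    (h0 : (0 : ℝ) ∉ Ioo a b) {q p : ℝ → ℝ} (hp : ContinuousOn p (Icc a b))
    (hpq : ∀ x, x ≠ 0 → p x = q x) {lam : ℂ} {u : ℝ → ℂ}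
    (hu : IsSolutionOn (Icc a b) α q lam u) {x : ℝ} (hx : x ∈ Ico a b) :
    HasDerivWithinAt (iteratedDerivWithin 3 u (Icc a b))
      ((lam - p x) / (α : ℂ) ^ 4 * u x) (Ici x) x := by
  have hab : a < b := hx.1.trans_lt hx.2
  have hα' : (α : ℂ) ≠ 0 := by exact_mod_cast hα.ne'
  have heq : ∀ y ∈ Icc a b, y ≠ 0 → HasDerivWithinAt (iteratedDerivWithin 3 u (Icc a b))
      ((lam - p y) / (α : ℂ) ^ 4 * u y) (Icc a b) y := fun y hy hy0 => by
    obtain ⟨d, hd, he⟩ := hu.equation y ⟨hy, hy0⟩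
    convert hd using 1
    rw [hpq y hy0]
    field_simp
    linear_combination -he
  -- At `0` the equation is not imposed. There `0` must be the left end point, and the right
  -- derivative is the limit of the derivatives at nearby points.
  by_cases hx0 : x = 0
  · have hxa : x = a := by
      by_contra h
      exact h0 (hx0 ▸ ⟨lt_of_le_of_ne hx.1 (Ne.symm h), hx.2⟩)
    subst hxa
    have hderiv : ∀ y ∈ Ioo x b, HasDerivAt (iteratedDerivWithin 3 u (Icc x b))
        ((lam - p y) / (α : ℂ) ^ 4 * u y) y := fun y hy =>
      (heq y (Ioo_subset_Icc_self hy) (by rw [← hx0]; exact hy.1.ne')).hasDerivAt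
        (Icc_mem_nhds hy.1 hy.2)
    have hmem : Ioo x b ∈ 𝓝[>] x := Ioo_mem_nhdsGT hab
    have hxm : x ∈ Icc x b := left_mem_Icc.2 hab.le
    refine hasDerivWithinAt_Ici_of_tendsto_deriv (s := Ioo x b)
      (fun y hy => (hderiv y hy).differentiableAt.differentiableWithinAt)
      ((hu.continuousOn_iteratedDerivWithin hab le_rfl x hxm).mono Ioo_subset_Icc_self) hmem ?_
    have hcont : ContinuousWithinAt (fun y => (lam - p y) / (α : ℂ) ^ 4 * u y) (Icc x b) x := by
      have h1 : ContinuousWithinAt (fun y => (p y : ℂ)) (Icc x b) x :=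
        Complex.continuous_ofReal.continuousAt.comp_continuousWithinAt (hp x hxm)
      exact ((continuousWithinAt_const.sub h1).div_const _).mul (hu.contDiffOn.continuousOn x hxm)
    have h2 : Tendsto (fun y => (lam - p y) / (α : ℂ) ^ 4 * u y) (𝓝[>] x)
        (𝓝 ((lam - p x) / (α : ℂ) ^ 4 * u x)) :=
      hcont.tendsto.mono_left (nhdsWithin_le_of_mem
        (mem_of_superset hmem Ioo_subset_Icc_self))
    refine h2.congr' ?_
    filter_upwards [hmem] with y hy
    exact (hderiv y hy).deriv.symm
  · exact (heq x (Ico_subset_Icc_self hx) hx0).mono_of_mem_nhdsWithin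
      (Icc_mem_nhdsGE_of_mem hx)

/-- A solution whose Cauchy data are of weighted size `A` at `a` differs from a solution `V` of the
equation without potential by the contribution of the difference of the Cauchy data, of weighted
size `B`, and by a term of weighted size `A / r³`. -/
theorem norm_iteratedDerivWithin_sub_le {a b α Q : ℝ} (hα : 0 < α) (hab : a < b)
    (h0 : (0 : ℝ) ∉ Ioo a b) {q p : ℝ → ℝ} (hp : ContinuousOn p (Icc a b))
    (hpq : ∀ x, x ≠ 0 → p x = q x) (hQ : ∀ x ∈ Icc a b, |p x| / α ^ 4 ≤ Q)
    {s : ℂ} {r : ℝ} (hr : r = ‖s‖ / α) (hr1 : 1 ≤ r) {u : ℝ → ℂ}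
    (hu : IsSolutionOn (Icc a b) α q (s ^ 4) u) {V : ℕ → ℝ → ℂ}
    (hV : ∀ k x, HasDerivAt (V k) (V (k + 1) x) x) (hV4 : ∀ x, V 4 x = (s / α) ^ 4 * V 0 x)
    {A B : ℝ} (hA : ∀ k ≤ 3, ‖iteratedDerivWithin k u (Icc a b) a‖ ≤ r ^ k * A)
    (hB : ∀ k ≤ 3, ‖iteratedDerivWithin k u (Icc a b) a - V k a‖ ≤ r ^ k * B)
    {x : ℝ} (hx : x ∈ Icc a b) {k : ℕ} (hk : k ≤ 3) :
    ‖iteratedDerivWithin k u (Icc a b) x - V k x‖ ≤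
      r ^ k * ((B + Q * Real.exp (Q * (b - a)) * (b - a) * (A / r ^ 3))
        * Real.exp (r * (x - a))) := by
  have hr0 : 0 < r := by linarith
  have hQ0 : 0 ≤ Q := (by positivity : 0 ≤ |p a| / α ^ 4).trans (hQ a (left_mem_Icc.2 hab.le))
  have hA0 : 0 ≤ A := by simpa using (norm_nonneg _).trans (hA 0 (by norm_num))
  have hIci : ∀ {f : ℝ → ℂ} {d : ℂ} {y : ℝ}, y ∈ Ico a b → HasDerivWithinAt f d (Icc a b) y →
      HasDerivWithinAt f d (Ici y) y := fun hy h =>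
    h.mono_of_mem_nhdsWithin (Icc_mem_nhdsGE_of_mem hy)
  have hU := fun k (hk : k < 3) y (hy : y ∈ Ico a b) =>
    hIci hy (hu.hasDerivWithinAt_iteratedDerivWithin hab hk (Ico_subset_Icc_self hy))
  have hs : ‖(s / α) ^ 4‖ = r ^ 4 := by
    rw [hr, norm_pow, norm_div, Complex.norm_real, Real.norm_of_nonneg hα.le]
  have hpn : ∀ y ∈ Icc a b, ‖(p y : ℂ) / (α : ℂ) ^ 4‖ ≤ Q := fun y hy => by
    rw [norm_div, norm_pow, Complex.norm_real, Complex.norm_real, Real.norm_of_nonneg hα.le]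
    exact hQ y hy
  have hsplit : ∀ y, (s ^ 4 - p y) / (α : ℂ) ^ 4 = (s / α) ^ 4 - (p y : ℂ) / (α : ℂ) ^ 4 :=
    fun y => by rw [div_pow, sub_div]
  have hsize : ∀ y ∈ Icc a b,
      ‖u y‖ ≤ A * Real.exp (Q * (b - a)) * Real.exp (r * (y - a)) := by
    intro y hy
    -- A priori bound: since `r⁴ + Q ≤ (r + Q)⁴`, raising the rate to `r + Q` absorbs the potential,
    -- at the cost of the bounded factor `e^(Q (b - a))`.
    have h := norm_chain_le (r := r + Q) (A := A) (F := 0) (by positivity)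
      (fun k hk => hu.continuousOn_iteratedDerivWithin hab hk) hU
      (fun y hy => hu.hasDerivWithinAt_Ici hα h0 hp hpq hy)
      (fun y hy => by
        rw [norm_mul, iteratedDerivWithin_zero, hsplit]
        have h1 := (norm_sub_le ((s / (α : ℂ)) ^ 4) ((p y : ℂ) / (α : ℂ) ^ 4)).trans
          (add_le_add hs.le (hpn y (Ico_subset_Icc_self hy)))
        have h2 : r ^ 4 + Q ≤ (r + Q) ^ 4 := by
          have h3 : Q ≤ r ^ 3 * Q := le_mul_of_one_le_left hQ0 (one_le_pow₀ hr1)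
          have : 0 ≤ 3 * (r ^ 3 * Q) + 6 * (r ^ 2 * Q ^ 2) + 4 * (r * Q ^ 3) + Q ^ 4 := by
            positivity
          nlinarith
        simpa using mul_le_mul_of_nonneg_right (h1.trans h2) (norm_nonneg (u y)))
      le_rfl
      (fun k hk => (hA k hk).trans (by gcongr; linarith)) y hy 0 (by norm_num)
    simp only [iteratedDerivWithin_zero, pow_zero, one_mul, zero_mul, add_zero] at h
    refine h.trans ?_
    rw [mul_assoc, ← Real.exp_add]
    gcongr
    have : Q * (y - a) ≤ Q * (b - a) := by gcongr; exact hy.2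
    linarith
  -- The source `p u / α⁴` is bounded by `r³ F e^(r (y - a))`; the `r³` in the Grönwall hypothesis
  -- is where the gain `r⁻³` arises.
  set F : ℝ := Q * Real.exp (Q * (b - a)) * (A / r ^ 3) with hF
  have hF0 : 0 ≤ F := by positivity
  have h := norm_chain_le (r := r) (A := B) (F := F) hr0
    (w := fun k y => iteratedDerivWithin k u (Icc a b) y - V k y)
    (d := fun y => (s ^ 4 - p y) / (α : ℂ) ^ 4 * u y - V 4 y)
    (fun k hk => (hu.continuousOn_iteratedDerivWithin hab hk).sub
      (fun y _ => (hV k y).continuousAt.continuousWithinAt))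
    (fun k hk y hy => (hU k hk y hy).sub (hV k y).hasDerivWithinAt)
    (fun y hy => (hu.hasDerivWithinAt_Ici hα h0 hp hpq hy).sub (hV 3 y).hasDerivWithinAt)
    (fun y hy => by
      have hy' := Ico_subset_Icc_self hy
      have e : (s ^ 4 - p y) / (α : ℂ) ^ 4 * u y - V 4 y
          = (s / α) ^ 4 * (u y - V 0 y) - (p y : ℂ) / (α : ℂ) ^ 4 * u y := by
        rw [hV4, hsplit]; ring
      rw [e, iteratedDerivWithin_zero]
      refine (norm_sub_le _ _).trans ?_
      rw [norm_mul, norm_mul, hs]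
      refine add_le_add_right ?_ _
      calc ‖(p y : ℂ) / (α : ℂ) ^ 4‖ * ‖u y‖
          ≤ Q * (A * Real.exp (Q * (b - a)) * Real.exp (r * (y - a))) :=
            mul_le_mul (hpn y hy') (hsize y hy') (norm_nonneg _) hQ0
        _ = _ := by rw [hF]; field_simp)
    hF0 hB x hx k hk
  refine h.trans ?_
  have h5 : F * (x - a) ≤ F * (b - a) := by gcongr; exact hx.2
  have h6 : F * (b - a) = Q * Real.exp (Q * (b - a)) * (b - a) * (A / r ^ 3) := by
    rw [hF]; ring
  rw [← h6]
  gcongr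

/-- Form of `norm_iteratedDerivWithin_sub_le` with powers of `‖s‖` and a constant that depends on
the equation only. -/
theorem exists_norm_iteratedDerivWithin_sub_le {a b α : ℝ} (hα : 0 < α) (hab : a < b)
    (h0 : (0 : ℝ) ∉ Ioo a b) {q p : ℝ → ℝ} (hp : ContinuousOn p (Icc a b))
    (hpq : ∀ x, x ≠ 0 → p x = q x) :
    ∃ C, 0 ≤ C ∧ ∀ s : ℂ, max 1 α ≤ ‖s‖ → ∀ u : ℝ → ℂ,
      IsSolutionOn (Icc a b) α q (s ^ 4) u → ∀ V : ℕ → ℝ → ℂ,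
      (∀ k x, HasDerivAt (V k) (V (k + 1) x) x) → (∀ x, V 4 x = (s / α) ^ 4 * V 0 x) →
      ∀ A B : ℝ, (∀ k ≤ 3, ‖iteratedDerivWithin k u (Icc a b) a‖ ≤ ‖s‖ ^ k * A) →
      (∀ k ≤ 3, ‖iteratedDerivWithin k u (Icc a b) a - V k a‖ ≤ ‖s‖ ^ k * B) →
      ∀ x ∈ Icc a b, ∀ k ≤ 3,
        ‖iteratedDerivWithin k u (Icc a b) x - V k x‖ ≤
          C * (‖s‖ ^ k * (B + A / ‖s‖ ^ 3)) * Real.exp (‖s‖ * ((x - a) / α)) := by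
  obtain ⟨Q₀, hQ₀⟩ := isCompact_Icc.exists_bound_of_continuousOn hp
  set Q : ℝ := Q₀ / α ^ 4 with hQdef
  have hQ : ∀ x ∈ Icc a b, |p x| / α ^ 4 ≤ Q := fun x hx => by
    rw [hQdef]; gcongr; exact hQ₀ x hx
  have hQ0 : 0 ≤ Q := (by positivity : 0 ≤ |p a| / α ^ 4).trans (hQ a (left_mem_Icc.2 hab.le))
  set L : ℝ := Q * Real.exp (Q * (b - a)) * (b - a) with hL
  have hL0 : 0 ≤ L := by have := sub_pos.2 hab; positivity
  set m : ℝ := max 1 α with hm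
  have hm1 : 1 ≤ m := le_max_left _ _
  have hmα : α ≤ m := le_max_right _ _
  set m' : ℝ := max 1 α⁻¹ with hm'
  have hm'1 : 1 ≤ m' := le_max_left _ _
  have hm'α : α⁻¹ ≤ m' := le_max_right _ _
  -- `m³` converts the data bounds from powers of `‖s‖` to powers of `r`, `m'³` converts the
  -- conclusion back, and `α³` comes from `1 / r³ = α³ / ‖s‖³`.
  refine ⟨m' ^ 3 * m ^ 3 * (1 + L * α ^ 3), by positivity, ?_⟩
  intro s hs u hu V hV hV4 A B hA hB x hx k hk
  have hspos : 0 < ‖s‖ := by linarith [hm1]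
  set r : ℝ := ‖s‖ / α with hr
  have hr1 : 1 ≤ r := by rw [hr, one_le_div hα]; exact hmα.trans hs
  have hA0 : 0 ≤ A := by simpa using (norm_nonneg _).trans (hA 0 (by norm_num))
  have hB0 : 0 ≤ B := by simpa using (norm_nonneg _).trans (hB 0 (by norm_num))
  have hup : ∀ j ≤ 3, ‖s‖ ^ j ≤ r ^ j * m ^ 3 := fun j hj => by
    have : ‖s‖ = r * α := by rw [hr]; field_simp
    rw [this, mul_pow]
    gcongr
    exact (pow_le_pow_left₀ hα.le hmα j).trans (pow_le_pow_right₀ hm1 hj)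
  have hdown : r ^ k ≤ m' ^ 3 * ‖s‖ ^ k := by
    rw [hr, div_eq_mul_inv, mul_pow, mul_comm]
    gcongr
    exact (pow_le_pow_left₀ (by positivity) hm'α k).trans (pow_le_pow_right₀ hm'1 hk)
  have h := norm_iteratedDerivWithin_sub_le hα hab h0 hp hpq hQ hr hr1 hu hV hV4
    (A := m ^ 3 * A) (B := m ^ 3 * B)
    (fun j hj => (hA j hj).trans (by
      rw [← mul_assoc]; exact mul_le_mul_of_nonneg_right (hup j hj) hA0))
    (fun j hj => (hB j hj).trans (by
      rw [← mul_assoc]; exact mul_le_mul_of_nonneg_right (hup j hj) hB0)) hx hk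
  have he : r * (x - a) = ‖s‖ * ((x - a) / α) := by rw [hr]; ring
  have hr3 : m ^ 3 * A / r ^ 3 = m ^ 3 * α ^ 3 * (A / ‖s‖ ^ 3) := by
    rw [hr]; field_simp
  rw [he, ← hL, hr3] at h
  refine h.trans ?_
  rw [← mul_assoc]
  refine mul_le_mul_of_nonneg_right ?_ (Real.exp_nonneg _)
  have hD : 0 ≤ A / ‖s‖ ^ 3 := by positivity
  calc r ^ k * (m ^ 3 * B + L * (m ^ 3 * α ^ 3 * (A / ‖s‖ ^ 3)))
      ≤ (m' ^ 3 * ‖s‖ ^ k) * (m ^ 3 * B + L * (m ^ 3 * α ^ 3 * (A / ‖s‖ ^ 3))) := by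
        gcongr
    _ = m' ^ 3 * m ^ 3 * ‖s‖ ^ k * (B + L * α ^ 3 * (A / ‖s‖ ^ 3)) := by ring
    _ ≤ m' ^ 3 * m ^ 3 * ‖s‖ ^ k * ((1 + L * α ^ 3) * (B + A / ‖s‖ ^ 3)) := by
        gcongr
        have : 0 ≤ L * α ^ 3 * B := by positivity
        linarith
    _ = _ := by ring

/-! ### Leading parts as exponential solutions -/

/-- The `k`-th derivative of the combination of the exponentials `e^{c (x - x₀)}`,
`c ∈ {σ, -σ, σ i, -σ i}`, with coefficients `g₀, g₁, g₂, g₃`. -/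
noncomputable def quarticExp (σ : ℂ) (x₀ : ℝ) (g₀ g₁ g₂ g₃ : ℂ) (k : ℕ) (x : ℝ) : ℂ :=
  g₀ * σ ^ k * Complex.exp (σ * (x - x₀)) + g₁ * (-σ) ^ k * Complex.exp (-σ * (x - x₀))
    + g₂ * (σ * Complex.I) ^ k * Complex.exp (σ * Complex.I * (x - x₀))
    + g₃ * (-(σ * Complex.I)) ^ k * Complex.exp (-(σ * Complex.I) * (x - x₀))

theorem hasDerivAt_quarticExp (σ : ℂ) (x₀ : ℝ) (g₀ g₁ g₂ g₃ : ℂ) (k : ℕ) (x : ℝ) :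
    HasDerivAt (quarticExp σ x₀ g₀ g₁ g₂ g₃ k) (quarticExp σ x₀ g₀ g₁ g₂ g₃ (k + 1) x) x := by
  have h : ∀ g c : ℂ, HasDerivAt (fun x : ℝ => g * c ^ k * Complex.exp (c * (x - x₀)))
      (g * c ^ (k + 1) * Complex.exp (c * (x - x₀))) x := fun g c => by
    have h1 : HasDerivAt (fun x : ℝ => (x : ℂ)) 1 x := by
      simpa using (hasDerivAt_id x).ofReal_comp
    refine (((h1.sub_const (x₀ : ℂ)).const_mul c).cexp.const_mul (g * c ^ k)).congr_deriv ?_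
    ring
  exact (((h g₀ σ).add (h g₁ (-σ))).add (h g₂ (σ * Complex.I))).add (h g₃ (-(σ * Complex.I)))

/-- All four exponents are fourth roots of `σ⁴`; this qualifies the leading parts as comparison
functions. -/
theorem quarticExp_four (σ : ℂ) (x₀ : ℝ) (g₀ g₁ g₂ g₃ : ℂ) (x : ℝ) :
    quarticExp σ x₀ g₀ g₁ g₂ g₃ 4 x = σ ^ 4 * quarticExp σ x₀ g₀ g₁ g₂ g₃ 0 x := by
  have h : (σ * Complex.I) ^ 4 = σ ^ 4 := by rw [mul_pow, Complex.I_pow_four, mul_one]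
  have h' : (-(σ * Complex.I)) ^ 4 = σ ^ 4 := by rw [Even.neg_pow (by decide), h]
  simp only [quarticExp, h, h']
  ring

theorem iteratedDeriv_quarticExp {σ : ℂ} {x₀ : ℝ} {g₀ g₁ g₂ g₃ : ℂ} {f : ℝ → ℂ}
    (hf : ∀ x, f x = quarticExp σ x₀ g₀ g₁ g₂ g₃ 0 x) (k : ℕ) (x : ℝ) :
    iteratedDeriv k f x = quarticExp σ x₀ g₀ g₁ g₂ g₃ k x := by
  rw [funext hf]
  exact congrFun (iteratedDeriv_of_chain (hasDerivAt_quarticExp σ x₀ g₀ g₁ g₂ g₃) k) x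

theorem iteratedDeriv_cos_eq (σ : ℂ) (x₀ : ℝ) (k : ℕ) (x : ℝ) :
    iteratedDeriv k (fun y : ℝ => Complex.cos (σ * (y - x₀))) x
      = quarticExp σ x₀ 0 0 (1 / 2) (1 / 2) k x := by
  refine iteratedDeriv_quarticExp (fun y => ?_) k x
  have h1 : σ * (y - x₀) * Complex.I = σ * Complex.I * (y - x₀) := by ring
  have h2 : -(σ * (y - x₀)) * Complex.I = -(σ * Complex.I) * (y - x₀) := by ring
  rw [Complex.cos, h1, h2]
  simp only [quarticExp]
  ring

theorem iteratedDeriv_sin_eq (σ : ℂ) (x₀ : ℝ) (k : ℕ) (x : ℝ) :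
    iteratedDeriv k (fun y : ℝ => Complex.sin (σ * (y - x₀))) x
      = quarticExp σ x₀ 0 0 (-Complex.I / 2) (Complex.I / 2) k x := by
  refine iteratedDeriv_quarticExp (fun y => ?_) k x
  have h1 : σ * (y - x₀) * Complex.I = σ * Complex.I * (y - x₀) := by ring
  have h2 : -(σ * (y - x₀)) * Complex.I = -(σ * Complex.I) * (y - x₀) := by ring
  rw [Complex.sin, h1, h2]
  simp only [quarticExp]
  ring

theorem iteratedDeriv_exp_add_eq (σ : ℂ) (x₀ : ℝ) (k : ℕ) (x : ℝ) :
    iteratedDeriv k (fun y : ℝ =>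
      Complex.exp (σ * (y - x₀)) + Complex.exp (-(σ * (y - x₀)))) x
      = quarticExp σ x₀ 1 1 0 0 k x := by
  refine iteratedDeriv_quarticExp (fun y => ?_) k x
  simp [quarticExp]

theorem iteratedDeriv_exp_sub_eq (σ : ℂ) (x₀ : ℝ) (k : ℕ) (x : ℝ) :
    iteratedDeriv k (fun y : ℝ =>
      Complex.exp (σ * (y - x₀)) - Complex.exp (-(σ * (y - x₀)))) x
      = quarticExp σ x₀ 1 (-1) 0 0 k x := by
  refine iteratedDeriv_quarticExp (fun y => ?_) k x
  simp [quarticExp]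
  ring

theorem leftLeading_eq (a₁ β₂ : ℝ) (s : ℂ) (k : ℕ) (x : ℝ) :
    leftLeading a₁ β₂ s k x = quarticExp (s / a₁) (-1)
      (β₂ * a₁ / (4 * s)) (-(β₂ * a₁ / (4 * s)))
      (-Complex.I / 2 * (β₂ * a₁ / (2 * s))) (Complex.I / 2 * (β₂ * a₁ / (2 * s))) k x := by
  have h : ∀ y : ℝ, s * ((y : ℂ) + 1) / a₁ = s / a₁ * (y - ((-1 : ℝ) : ℂ)) := fun y => by
    push_cast; ring
  simp only [leftLeading, h, iteratedDeriv_sin_eq, iteratedDeriv_exp_sub_eq]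
  simp only [quarticExp]
  ring

theorem rightLeading_eq (a₂ δ₁ δ₂ : ℝ) (p₀ p₁ s : ℂ) (k : ℕ) (x : ℝ) :
    rightLeading a₂ δ₁ δ₂ p₀ p₁ s k x = quarticExp (s / a₂) 0
      (-((a₂ : ℂ) ^ 2 * s ^ 2 * δ₁ * p₁ / 4) - (a₂ : ℂ) ^ 3 * s * δ₂ * p₀ / 4)
      (-((a₂ : ℂ) ^ 2 * s ^ 2 * δ₁ * p₁ / 4) + (a₂ : ℂ) ^ 3 * s * δ₂ * p₀ / 4)
      ((a₂ : ℂ) ^ 2 * s ^ 2 * δ₁ * p₁ / 4 - Complex.I * ((a₂ : ℂ) ^ 3 * s * δ₂ * p₀ / 4))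
      ((a₂ : ℂ) ^ 2 * s ^ 2 * δ₁ * p₁ / 4 + Complex.I * ((a₂ : ℂ) ^ 3 * s * δ₂ * p₀ / 4))
      k x := by
  have h : ∀ y : ℝ, s * (y : ℂ) / a₂ = s / a₂ * (y - ((0 : ℝ) : ℂ)) := fun y => by
    push_cast; ring
  simp only [rightLeading, h, iteratedDeriv_sin_eq, iteratedDeriv_cos_eq,
    iteratedDeriv_exp_sub_eq, iteratedDeriv_exp_add_eq]
  simp only [quarticExp]
  ring

/-- Only the datum `β₂` is carried by the leading part; `-β₁` is left to the remainder. -/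
theorem leftLeading_neg_one {a₁ : ℝ} (ha : a₁ ≠ 0) (β₂ : ℝ) {s : ℂ} (hs : s ≠ 0) :
    leftLeading a₁ β₂ s 0 (-1) = 0 ∧ leftLeading a₁ β₂ s 1 (-1) = β₂ ∧
      leftLeading a₁ β₂ s 2 (-1) = 0 ∧ leftLeading a₁ β₂ s 3 (-1) = 0 := by
  have ha' : (a₁ : ℂ) ≠ 0 := by exact_mod_cast ha
  have hI := Complex.I_sq
  simp only [leftLeading_eq, quarticExp, sub_self, mul_zero, Complex.exp_zero, mul_one]
  refine ⟨by ring, ?_, by ring, ?_⟩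
  · field_simp
    linear_combination (-8 * β₂ : ℂ) * hI
  · field_simp
    linear_combination (-8 * β₂ * s ^ 2 * (Complex.I ^ 2 - 1) : ℂ) * hI

/-- These are exactly the jumps in the transmission conditions with `λ = s⁴`, so subtracting the
leading part leaves the data of the left solution. -/
theorem rightLeading_zero {a₂ : ℝ} (ha : a₂ ≠ 0) (δ₁ δ₂ : ℝ) (p₀ p₁ s : ℂ) :
    rightLeading a₂ δ₁ δ₂ p₀ p₁ s 0 0 = 0 ∧ rightLeading a₂ δ₁ δ₂ p₀ p₁ s 1 0 = 0 ∧
      rightLeading a₂ δ₁ δ₂ p₀ p₁ s 2 0 = -(s ^ 4 * δ₁ * p₁) ∧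
      rightLeading a₂ δ₁ δ₂ p₀ p₁ s 3 0 = -(s ^ 4 * δ₂ * p₀) := by
  have ha' : (a₂ : ℂ) ≠ 0 := by exact_mod_cast ha
  have hI := Complex.I_sq
  simp only [rightLeading_eq, quarticExp, sub_self, mul_zero, Complex.exp_zero, mul_one]
  refine ⟨by ring, ?_, ?_, ?_⟩
  · field_simp
    ring_nf
    simp only [hI]
    ring
  · field_simp
    ring_nf
    simp only [hI]
    ring
  · field_simp
    ring_nf
    simp only [Complex.I_pow_four]
    ring

/-! ### Solvability and estimates on the two intervals -/

theorem continuousOn_update_left {q : ℝ → ℝ} (hq : ContinuousOn q (Ico (-1) 0 ∪ Ioc 0 1)) {l : ℝ}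
    (hl : Tendsto q (𝓝[<] 0) (𝓝 l)) : ContinuousOn (Function.update q 0 l) leftI := by
  refine continuousOn_update_iff.2 ⟨hq.mono fun x hx => .inl ⟨hx.1.1, ?_⟩, fun _ => ?_⟩
  · exact lt_of_le_of_ne hx.1.2 hx.2
  · exact hl.mono_left (nhdsWithin_mono _ fun x hx => lt_of_le_of_ne hx.1.2 hx.2)

theorem continuousOn_update_right {q : ℝ → ℝ} (hq : ContinuousOn q (Ico (-1) 0 ∪ Ioc 0 1)) {l : ℝ}
    (hl : Tendsto q (𝓝[>] 0) (𝓝 l)) : ContinuousOn (Function.update q 0 l) rightI := by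
  refine continuousOn_update_iff.2 ⟨hq.mono fun x hx => .inr ⟨?_, hx.1.2⟩, fun _ => ?_⟩
  · exact lt_of_le_of_ne hx.1.1 (Ne.symm hx.2)
  · exact hl.mono_left (nhdsWithin_mono _ fun x hx => lt_of_le_of_ne hx.1.1 (Ne.symm hx.2))

theorem exists_isSolutionOn {a b α : ℝ} (hα : 0 < α) (hab : a < b) {q p : ℝ → ℝ}
    (hp : ContinuousOn p (Icc a b)) (hpq : ∀ x, x ≠ 0 → p x = q x) (lam c₀ c₁ c₂ c₃ : ℂ) :
    ∃ u, IsSolutionOn (Icc a b) α q lam u ∧ HasCauchyData (Icc a b) a u c₀ c₁ c₂ c₃ := by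
  have hα' : (α : ℂ) ≠ 0 := by exact_mod_cast hα.ne'
  have hpc : ContinuousOn (fun x => (lam - p x) / (α : ℂ) ^ 4) (Icc a b) :=
    (continuousOn_const.sub (Complex.continuous_ofReal.comp_continuousOn hp)).div_const _
  obtain ⟨u, hu, hd, he⟩ := exists_fourth_order_solution hab hpc c₀ c₁ c₂ c₃
  refine ⟨u, ⟨hu, fun x hx => ⟨_, he x hx.1, ?_⟩⟩, hd⟩
  rw [hpq x hx.2]
  field_simp
  ring

theorem hasDerivAt_leftLeading (a₁ β₂ : ℝ) (s : ℂ) (k : ℕ) (x : ℝ) :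
    HasDerivAt (leftLeading a₁ β₂ s k) (leftLeading a₁ β₂ s (k + 1) x) x := by
  rw [funext (leftLeading_eq a₁ β₂ s k), leftLeading_eq]
  exact hasDerivAt_quarticExp ..

theorem leftLeading_four (a₁ β₂ : ℝ) (s : ℂ) (x : ℝ) :
    leftLeading a₁ β₂ s 4 x = (s / a₁) ^ 4 * leftLeading a₁ β₂ s 0 x := by
  rw [leftLeading_eq, leftLeading_eq, quarticExp_four]

theorem hasDerivAt_rightLeading (a₂ δ₁ δ₂ : ℝ) (p₀ p₁ s : ℂ) (k : ℕ) (x : ℝ) :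
    HasDerivAt (rightLeading a₂ δ₁ δ₂ p₀ p₁ s k) (rightLeading a₂ δ₁ δ₂ p₀ p₁ s (k + 1) x) x := by
  rw [funext (rightLeading_eq a₂ δ₁ δ₂ p₀ p₁ s k), rightLeading_eq]
  exact hasDerivAt_quarticExp ..

theorem rightLeading_four (a₂ δ₁ δ₂ : ℝ) (p₀ p₁ s : ℂ) (x : ℝ) :
    rightLeading a₂ δ₁ δ₂ p₀ p₁ s 4 x = (s / a₂) ^ 4 * rightLeading a₂ δ₁ δ₂ p₀ p₁ s 0 x := by
  rw [rightLeading_eq, rightLeading_eq, quarticExp_four]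

/-- Growth of a solution on the left interval, with the size of its Cauchy data at `-1`. -/
theorem exists_norm_left_le {a₁ : ℝ} (ha₁ : 0 < a₁) {q p : ℝ → ℝ}
    (hp : ContinuousOn p leftI) (hpq : ∀ x, x ≠ 0 → p x = q x) :
    ∃ C, 0 ≤ C ∧ ∀ s : ℂ, max 1 a₁ ≤ ‖s‖ → ∀ u : ℝ → ℂ, IsSolutionOn leftI a₁ q (s ^ 4) u →
      ∀ A : ℝ, (∀ k ≤ 3, ‖iteratedDerivWithin k u leftI (-1)‖ ≤ ‖s‖ ^ k * A) →
      ∀ x ∈ leftI, ∀ k ≤ 3, ‖iteratedDerivWithin k u leftI x‖ ≤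
        C * (‖s‖ ^ k * A) * Real.exp (‖s‖ * ((x + 1) / a₁)) := by
  obtain ⟨C, hC0, hC⟩ := exists_norm_iteratedDerivWithin_sub_le ha₁ (by norm_num)
    (by simp) hp hpq
  refine ⟨2 * C, by positivity, fun s hs u hu A hA x hx k hk => ?_⟩
  have hs1 : 1 ≤ ‖s‖ := (le_max_left _ _).trans hs
  have hA0 : 0 ≤ A := by simpa using (norm_nonneg _).trans (hA 0 (by norm_num))
  -- Comparison with `V = 0`, for which the mismatch `B` is the size `A` itself.
  have h := hC s hs u hu (fun _ _ => 0) (fun _ x => hasDerivAt_const x 0) (fun _ => by simp)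
    A A hA (by simpa using hA) x hx k hk
  rw [sub_zero, sub_neg_eq_add] at h
  refine h.trans (mul_le_mul_of_nonneg_right ?_ (Real.exp_nonneg _))
  have : A / ‖s‖ ^ 3 ≤ A := div_le_self hA0 (one_le_pow₀ hs1)
  calc C * (‖s‖ ^ k * (A + A / ‖s‖ ^ 3)) ≤ C * (‖s‖ ^ k * (A + A)) := by gcongr
    _ = _ := by ring

/-- The solution on the right interval differs from its leading part by at most the order of the
solution on the left interval that it continues. -/
theorem exists_norm_right_sub_leading_le {a₂ : ℝ} (ha₂ : 0 < a₂) {q p : ℝ → ℝ}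
    (hp : ContinuousOn p rightI) (hpq : ∀ x, x ≠ 0 → p x = q x) (δ₁ δ₂ : ℝ) :
    ∃ C, 0 ≤ C ∧ ∀ s : ℂ, max 1 a₂ ≤ ‖s‖ → ∀ u v : ℝ → ℂ, IsSolutionOn rightI a₂ q (s ^ 4) v →
      Transmits δ₁ δ₂ (s ^ 4) u v →
      ∀ P : ℝ, (∀ k ≤ 3, ‖iteratedDerivWithin k u leftI 0‖ ≤ ‖s‖ ^ k * P) →
      ∀ x ∈ rightI, ∀ k ≤ 3, ‖iteratedDerivWithin k v rightI x
          - rightLeading a₂ δ₁ δ₂ (u 0) (iteratedDerivWithin 1 u leftI 0) s k x‖ ≤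
        C * (‖s‖ ^ k * P) * Real.exp (‖s‖ * (x / a₂)) := by
  obtain ⟨C, hC0, hC⟩ := exists_norm_iteratedDerivWithin_sub_le ha₂ one_pos
    (by simp) hp hpq
  refine ⟨C * (2 + |δ₁| + |δ₂|), by positivity, fun s hs u v hv huv P hP x hx k hk => ?_⟩
  have hs1 : 1 ≤ ‖s‖ := (le_max_left _ _).trans hs
  have hs0 : 0 < ‖s‖ := by linarith
  have hP0 : 0 ≤ P := by simpa using (norm_nonneg _).trans (hP 0 (by norm_num))
  set V := rightLeading a₂ δ₁ δ₂ (u 0) (iteratedDerivWithin 1 u leftI 0) s with hV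
  obtain ⟨hV0, hV1, hV2, hV3⟩ :=
    rightLeading_zero ha₂.ne' δ₁ δ₂ (u 0) (iteratedDerivWithin 1 u leftI 0) s
  obtain ⟨hv0, hv1, hv2, hv3⟩ := huv
  have hdiff : ∀ j ≤ 3, iteratedDerivWithin j v rightI 0 - V j 0
      = iteratedDerivWithin j u leftI 0 := by
    intro j hj
    interval_cases j
    · rw [iteratedDerivWithin_zero, iteratedDerivWithin_zero, hv0, hV, hV0, sub_zero]
    · rw [hv1, hV, hV1, sub_zero]
    · rw [hv2, hV, hV2]; ring
    · rw [hv3, hV, hV3]; ring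
  -- The exponent `3` is forced by `j = 2`: `|s⁴ δ₁ u'(0)|` is of order `‖s‖⁵ P = ‖s‖² ‖s‖³ P`. For
  -- `j = 3` there is room to spare.
  have hVn : ∀ j ≤ 3, ‖V j 0‖ ≤ ‖s‖ ^ j * ((|δ₁| + |δ₂|) * ‖s‖ ^ 3 * P) := by
    have h1 := hP 1 (by norm_num)
    have h0 := hP 0 (by norm_num)
    rw [iteratedDerivWithin_zero] at h0
    intro j hj
    interval_cases j
    · rw [hV, hV0, norm_zero]; positivity
    · rw [hV, hV1, norm_zero]; positivity
    · rw [hV, hV2, norm_neg, norm_mul, norm_mul, norm_pow, Complex.norm_real, Real.norm_eq_abs]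
      calc ‖s‖ ^ 4 * |δ₁| * ‖iteratedDerivWithin 1 u leftI 0‖
          ≤ ‖s‖ ^ 4 * (|δ₁| + |δ₂|) * (‖s‖ ^ 1 * P) := by
            gcongr; exact le_add_of_nonneg_right (abs_nonneg _)
        _ = _ := by ring
    · rw [hV, hV3, norm_neg, norm_mul, norm_mul, norm_pow, Complex.norm_real, Real.norm_eq_abs]
      calc ‖s‖ ^ 4 * |δ₂| * ‖u 0‖
          ≤ ‖s‖ ^ 4 * (|δ₁| + |δ₂|) * (‖s‖ ^ 0 * P) := by
            gcongr; exact le_add_of_nonneg_left (abs_nonneg _)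
        _ = ‖s‖ ^ 4 * ((|δ₁| + |δ₂|) * P) := by ring
        _ ≤ ‖s‖ ^ 6 * ((|δ₁| + |δ₂|) * P) := by gcongr; norm_num
        _ = _ := by ring
  have h := hC s hs v hv V (hasDerivAt_rightLeading _ _ _ _ _ _) (rightLeading_four _ _ _ _ _ _)
    ((1 + |δ₁| + |δ₂|) * ‖s‖ ^ 3 * P) P
    (fun j hj => by
      have e : iteratedDerivWithin j v rightI 0 = iteratedDerivWithin j u leftI 0 + V j 0 := by
        rw [← hdiff j hj]; ring
      have h3 : P ≤ ‖s‖ ^ 3 * P := le_mul_of_one_le_left hP0 (one_le_pow₀ hs1)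
      calc ‖iteratedDerivWithin j v rightI 0‖
          ≤ ‖s‖ ^ j * P + ‖s‖ ^ j * ((|δ₁| + |δ₂|) * ‖s‖ ^ 3 * P) := by
            rw [e]; exact (norm_add_le _ _).trans (add_le_add (hP j hj) (hVn j hj))
        _ ≤ ‖s‖ ^ j * (‖s‖ ^ 3 * P) + ‖s‖ ^ j * ((|δ₁| + |δ₂|) * ‖s‖ ^ 3 * P) := by gcongr
        _ = _ := by ring)
    (fun j hj => by rw [hdiff j hj]; exact hP j hj) x hx k hk
  rw [sub_zero] at h
  refine h.trans_eq ?_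
  congr 1
  field_simp
  ring

/-! ### The four asymptotic formulas -/

theorem lemma4p2 (a₁ a₂ : ℝ) (ha₁ : 0 < a₁) (ha₂ : 0 < a₂)
    (q : ℝ → ℝ) (hq : ContinuousOn q (Ico (-1) 0 ∪ Ioc 0 1))
    (hq_left : ∃ l : ℝ, Tendsto q (𝓝[<] 0) (𝓝 l))
    (hq_right : ∃ l : ℝ, Tendsto q (𝓝[>] 0) (𝓝 l))
    (β₁ β₂ δ₁ δ₂ : ℝ) (hβ : |β₁| + |β₂| ≠ 0) (hδ : |δ₁| + |δ₂| ≠ 0) :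
    (∀ lam : ℂ, ∃ φ₁₁ φ₁₂ φ₂₁ φ₂₂ : ℝ → ℂ,
      IsPhiSystem a₁ a₂ q β₁ β₂ δ₁ δ₂ lam φ₁₁ φ₁₂ φ₂₁ φ₂₂) ∧
    ∀ φ₁₁ φ₁₂ φ₂₁ φ₂₂ : ℝ → ℂ → ℂ,
      (∀ lam : ℂ, IsPhiSystem a₁ a₂ q β₁ β₂ δ₁ δ₂ lam
        (fun x => φ₁₁ x lam) (fun x => φ₁₂ x lam) (fun x => φ₂₁ x lam) (fun x => φ₂₂ x lam)) →
      ∀ k : ℕ, k ≤ 3 →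
        UniformBigO leftI
          (fun x s => iteratedDerivWithin k (fun y => φ₁₁ y (s ^ 4)) leftI x)
          (fun x s => ‖s‖ ^ ((k : ℤ) - 1) * Real.exp (‖s‖ * ((x + 1) / a₁))) ∧
        UniformBigO rightI
          (fun x s => iteratedDerivWithin k (fun y => φ₁₂ y (s ^ 4)) rightI x
            - rightLeading a₂ δ₁ δ₂ (φ₁₁ 0 (s ^ 4))
                (iteratedDerivWithin 1 (fun y => φ₁₁ y (s ^ 4)) leftI 0) s k x)
          (fun x s => ‖s‖ ^ k * Real.exp (‖s‖ * ((a₁ * x + a₂) / (a₁ * a₂)))) ∧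
        UniformBigO leftI
          (fun x s => iteratedDerivWithin k (fun y => φ₂₁ y (s ^ 4)) leftI x
            - leftLeading a₁ β₂ s k x)
          (fun x s => ‖s‖ ^ ((k : ℤ) - 2) * Real.exp (‖s‖ * ((x + 1) / a₁))) ∧
        UniformBigO rightI
          (fun x s => iteratedDerivWithin k (fun y => φ₂₂ y (s ^ 4)) rightI x
            - rightLeading a₂ δ₁ δ₂ (φ₂₁ 0 (s ^ 4))
                (iteratedDerivWithin 1 (fun y => φ₂₁ y (s ^ 4)) leftI 0) s k x)
          (fun x s => ‖s‖ ^ ((k : ℤ) - 1)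
            * Real.exp (‖s‖ * ((a₁ * x + a₂) / (a₁ * a₂)))) := by
  obtain ⟨l, hl⟩ := hq_left
  obtain ⟨l', hl'⟩ := hq_right
  have hpL := continuousOn_update_left hq hl
  have hpR := continuousOn_update_right hq hl'
  have hpq : ∀ l x, x ≠ 0 → Function.update q 0 l x = q x := fun l x hx =>
    Function.update_of_ne hx l q
  constructor
  · intro lam
    obtain ⟨φ₁₁, h₁₁, i₁₁⟩ := exists_isSolutionOn ha₁ (by norm_num) hpL (hpq l) lam 0 0 0 (-1)
    obtain ⟨φ₂₁, h₂₁, i₂₁⟩ := exists_isSolutionOn ha₁ (by norm_num) hpL (hpq l) lam 0 β₂ (-β₁) 0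
    -- The data left open here are fixed by unification with the transmission conditions.
    obtain ⟨φ₁₂, h₁₂, i₁₂⟩ := exists_isSolutionOn ha₂ one_pos hpR (hpq l') lam _ _ _ _
    obtain ⟨φ₂₂, h₂₂, i₂₂⟩ := exists_isSolutionOn ha₂ one_pos hpR (hpq l') lam _ _ _ _
    exact ⟨φ₁₁, φ₁₂, φ₂₁, φ₂₂, h₁₁, i₁₁, h₁₂, i₁₂, h₂₁, i₂₁, h₂₂, i₂₂⟩
  intro φ₁₁ φ₁₂ φ₂₁ φ₂₂ hφ k hk
  obtain ⟨C, hC0, hC⟩ := exists_norm_left_le ha₁ hpL (hpq l)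
  obtain ⟨D, hD0, hD⟩ := exists_norm_right_sub_leading_le ha₂ hpR (hpq l') δ₁ δ₂
  obtain ⟨G, hG0, hG⟩ := exists_norm_iteratedDerivWithin_sub_le ha₁ (by norm_num)
    (by simp) hpL (hpq l)
  have hexp : ∀ (s : ℂ) (x : ℝ), Real.exp (‖s‖ * ((0 + 1) / a₁)) * Real.exp (‖s‖ * (x / a₂))
      = Real.exp (‖s‖ * ((a₁ * x + a₂) / (a₁ * a₂))) := fun s x => by
    rw [← Real.exp_add]; congr 1; field_simp; ring
  have hz : ∀ (s : ℂ), 1 ≤ ‖s‖ → ∀ m : ℕ, ‖s‖ ^ ((k : ℤ) - m) = ‖s‖ ^ k / ‖s‖ ^ m := by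
    intro s hs m
    rw [zpow_sub₀ (by positivity), zpow_natCast, zpow_natCast]
  have h0 : (0 : ℝ) ∈ leftI := ⟨by norm_num, le_rfl⟩
  set R := max (max 1 a₁) a₂ with hR
  have hR1 : ∀ s : ℂ, R ≤ ‖s‖ → 1 ≤ ‖s‖ ∧ max 1 a₁ ≤ ‖s‖ ∧ max 1 a₂ ≤ ‖s‖ := by
    intro s hs
    simp only [hR, max_le_iff] at hs ⊢
    tauto
  -- The only nonzero datum is the third derivative, so the weighted size is `‖s‖⁻³`. This is
  -- stronger than needed: both estimates for `φ₁₁` and `φ₁₂` discard powers of `‖s‖`.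
  have h₁₁ : ∀ s : ℂ, R ≤ ‖s‖ → ∀ x ∈ leftI, ∀ k ≤ 3,
      ‖iteratedDerivWithin k (fun y => φ₁₁ y (s ^ 4)) leftI x‖ ≤
        C * (‖s‖ ^ k * (1 / ‖s‖ ^ 3)) * Real.exp (‖s‖ * ((x + 1) / a₁)) := by
    intro s hs
    obtain ⟨hs1, hs2, -⟩ := hR1 s hs
    have hs0 : 0 < ‖s‖ := by linarith
    obtain ⟨i0, i1, i2, i3⟩ := (hφ (s ^ 4)).init₁₁
    beta_reduce at i0
    refine hC s hs2 _ (hφ (s ^ 4)).sol₁₁ _ fun j hj => ?_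
    interval_cases j
    · rw [iteratedDerivWithin_zero, i0, norm_zero]; positivity
    · rw [i1, norm_zero]; positivity
    · rw [i2, norm_zero]; positivity
    · rw [i3, norm_neg, norm_one, mul_one_div_cancel (by positivity)]
  have hdata : ∀ s : ℂ, R ≤ ‖s‖ → ∀ k ≤ 3,
      ‖iteratedDerivWithin k (fun y => φ₂₁ y (s ^ 4)) leftI (-1)‖ ≤
        ‖s‖ ^ k * ((|β₁| + |β₂|) / ‖s‖) := by
    intro s hs j hj
    have hs1 := (hR1 s hs).1
    have hs0 : 0 < ‖s‖ := by linarith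
    obtain ⟨i0, i1, i2, i3⟩ := (hφ (s ^ 4)).init₂₁
    beta_reduce at i0
    have h1 := abs_nonneg β₁
    have h2 := abs_nonneg β₂
    interval_cases j
    · rw [iteratedDerivWithin_zero, i0, norm_zero]; positivity
    · rw [i1, Complex.norm_real, Real.norm_eq_abs, pow_one, mul_div_cancel₀ _ hs0.ne']
      linarith
    · rw [i2, norm_neg, Complex.norm_real, Real.norm_eq_abs]
      calc |β₁| ≤ |β₁| + |β₂| := by linarith
        _ ≤ ‖s‖ * (|β₁| + |β₂|) := le_mul_of_one_le_left (by positivity) hs1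
        _ = _ := by field_simp
    · rw [i3, norm_zero]; positivity
  have h₂₁ : ∀ s : ℂ, R ≤ ‖s‖ → ∀ x ∈ leftI, ∀ k ≤ 3,
      ‖iteratedDerivWithin k (fun y => φ₂₁ y (s ^ 4)) leftI x‖ ≤
        C * (‖s‖ ^ k * ((|β₁| + |β₂|) / ‖s‖)) * Real.exp (‖s‖ * ((x + 1) / a₁)) := fun s hs =>
    hC s (hR1 s hs).2.1 _ (hφ (s ^ 4)).sol₂₁ _ (hdata s hs)
  refine ⟨⟨C, R, fun s hs x hx => ?_⟩, ⟨D * C, R, fun s hs x hx => ?_⟩,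
    ⟨G * (2 * |β₁| + |β₂|), R, fun s hs x hx => ?_⟩,
    ⟨D * C * (|β₁| + |β₂|), R, fun s hs x hx => ?_⟩⟩
  · obtain ⟨hs1, -, -⟩ := hR1 s hs
    have h1 := hz s hs1 1
    rw [Nat.cast_one] at h1
    refine (h₁₁ s hs x hx k hk).trans ?_
    beta_reduce
    rw [h1, div_eq_mul_one_div (‖s‖ ^ k), mul_assoc C]
    have h3 : 1 / ‖s‖ ^ 3 ≤ 1 / ‖s‖ ^ 1 := by gcongr; norm_num
    gcongr
  · obtain ⟨hs1, -, hs2⟩ := hR1 s hs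
    refine (hD s hs2 (fun y => φ₁₁ y (s ^ 4)) _ (hφ (s ^ 4)).sol₁₂ (hφ (s ^ 4)).trans₁₂
      (C * (1 / ‖s‖ ^ 3) * Real.exp (‖s‖ * ((0 + 1) / a₁)))
      (fun j hj => (h₁₁ s hs 0 h0 j hj).trans_eq (by ring)) x hx k hk).trans ?_
    beta_reduce
    rw [← hexp]
    have h3 : 1 / ‖s‖ ^ 3 ≤ 1 := div_le_self zero_le_one (one_le_pow₀ hs1)
    calc _ = D * C * (‖s‖ ^ k * (Real.exp (‖s‖ * ((0 + 1) / a₁)) * Real.exp (‖s‖ * (x / a₂))))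
          * (1 / ‖s‖ ^ 3) := by ring
      _ ≤ _ := mul_le_of_le_one_right (by positivity) h3
  · obtain ⟨hs1, hs2, -⟩ := hR1 s hs
    have hs0 : 0 < ‖s‖ := by linarith
    obtain ⟨i0, i1, i2, i3⟩ := (hφ (s ^ 4)).init₂₁
    beta_reduce at i0
    obtain ⟨hV0, hV1, hV2, hV3⟩ :=
      leftLeading_neg_one ha₁.ne' β₂ (norm_pos_iff.1 hs0)
    have h1 := hz s hs1 2
    rw [Nat.cast_two] at h1
    -- The mismatch is only `-β₁` in the second derivative, hence `B = |β₁| / ‖s‖²`; the potential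
    -- contributes the smaller order `‖s‖⁻⁴`.
    have h := hG s hs2 _ (hφ (s ^ 4)).sol₂₁ (leftLeading a₁ β₂ s)
      (hasDerivAt_leftLeading _ _ _) (leftLeading_four _ _ _) _ (|β₁| / ‖s‖ ^ 2) (hdata s hs)
      (fun j hj => by
        interval_cases j
        · rw [iteratedDerivWithin_zero, i0, hV0, sub_zero, norm_zero]; positivity
        · rw [i1, hV1, sub_self, norm_zero]; positivity
        · rw [i2, hV2, sub_zero, norm_neg, Complex.norm_real, Real.norm_eq_abs]
          field_simp
          rfl
        · rw [i3, hV3, sub_zero, norm_zero]; positivity) x hx k hk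
    rw [sub_neg_eq_add] at h
    refine h.trans ?_
    beta_reduce
    rw [h1, ← mul_assoc (G * _)]
    refine mul_le_mul_of_nonneg_right ?_ (Real.exp_nonneg _)
    have h4 : (|β₁| + |β₂|) / ‖s‖ / ‖s‖ ^ 3 ≤ (|β₁| + |β₂|) / ‖s‖ ^ 2 := by
      rw [div_div, ← pow_succ']
      gcongr
      norm_num
    calc _ ≤ G * (‖s‖ ^ k * (|β₁| / ‖s‖ ^ 2 + (|β₁| + |β₂|) / ‖s‖ ^ 2)) := by gcongr
      _ = _ := by ring
  · obtain ⟨hs1, -, hs2⟩ := hR1 s hs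
    have h1 := hz s hs1 1
    rw [Nat.cast_one, pow_one] at h1
    -- Here `P` is of order `‖s‖⁻¹ e^(‖s‖ / a₁)`, which yields the exponent `k - 1` with no loss.
    refine (hD s hs2 (fun y => φ₂₁ y (s ^ 4)) _ (hφ (s ^ 4)).sol₂₂ (hφ (s ^ 4)).trans₂₂
      (C * ((|β₁| + |β₂|) / ‖s‖) * Real.exp (‖s‖ * ((0 + 1) / a₁)))
      (fun j hj => (h₂₁ s hs 0 h0 j hj).trans_eq (by ring)) x hx k hk).trans_eq ?_
    beta_reduce
    rw [← hexp, h1]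
    ring
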